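/- There is a universal constant $\alpha>0$ such that for every integer $d\in\mathbb N$ and every real $\gamma$ with $2^{-d}<\gamma<1/80$ there are a finite set $\mathcal X$, a concept class $\mathcal C\subseteq\{-1,1\}^{\mathcal X}$ and a hypothesis set $\mathcal H\subseteq\{-1,1\}^{\mathcal X}$ of VC-dimension at most $d$ with the following two properties. 1. For every $c\in\mathcal C$ and every probability distribution $\mathcal D'$ on $\mathcal X$ there is an $h\in\mathcal H$ with $\Pr_{x\sim\mathcal D'}[h(x)\neq c(x)]\le 1/2-\gamma$. 2. For every integer $m\ge 1$ and every $0<\delta<1/3$ there is a probability distribution $\mathcal D$ on $\mathcal X$ such that for every (possibly randomized) learning algorithm $\mathcal A$, i.e. every map that sends a labelled sample $((x_1,y_1),\dots,(x_m,y_m))\in(\mathcal X\times\{-1,1\})^m$ to a random hypothesis $\mathcal X\to\{-1,1\}$ (the map may depend on $\mathcal X,\mathcal C,\mathcal H,\mathcal D,m,\delta$), there is a concept $c\in\mathcal C$ such that, with probability at least $\delta$ over $m$ i.i.d. samples $S=(x_1,\dots,x_m)\sim\mathcal D^m$ and the randomness of $\mathcal A$, the hypothesis $h$ that $\mathcal A$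 outputs on $S$ with the labels $c(x_1),\dots,c(x_m)$ satisfies $$\Pr_{x\sim\mathcal D}[h(x)\neq c(x)]\;\ge\;\alpha\cdot\min\left\{1,\ \frac{d\gamma^{-2}+\ln(1/\delta)}{m}\right\}.$$ -/

import Mathlib

/-- A hypothesis set `H ⊆ X → {-1, 1}` shatters the finite set of points `T` if every labelling of
`T` is realized by some `h ∈ H`. Labels live in `ℤˣ = {-1, 1}`. -/
def Shatters {X : Type*} (H : Set (X → ℤˣ)) (T : Finset X) : Prop :=
  ∀ ℓ : X → ℤˣ, ∃ h ∈ H, ∀ x ∈ T, h x = ℓ x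

/-- The VC-dimension of `H`: the supremum of the cardinalities of the finite sets that `H`
shatters. -/
noncomputable def vcDimension {X : Type*} (H : Set (X → ℤˣ)) : ℕ∞ :=
  ⨆ (T : Finset X) (_ : Shatters H T), (T.card : ℕ∞)

/-- The loss `Pr_{x ∼ D} [h x ≠ c x]` of the hypothesis `h` with respect to the concept `c`. -/
noncomputable def loss {X : Type*} (D : PMF X) (c h : X → ℤˣ) : ℝ :=
  (D.toOuterMeasure {x | h x ≠ c x}).toReal

/-- The distribution `D ^ m` of `m` i.i.d. samples from `D`. -/
noncomputable def iidSample {X : Type*} [Fintype X] (D : PMF X) (m : ℕ) : PMF (Fin m → X) :=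
  PMF.ofFintype (fun S => ∏ i, D (S i)) (by
    classical
    have h : ∑ x, D x = 1 := by simpa [tsum_fintype] using D.tsum_coe
    rw [← Fintype.prod_sum (fun (_ : Fin m) x => D x)]
    simp [h])

/-- A (possibly randomized) learning algorithm for samples of size `m`: it receives `m` labelled
points and outputs a random hypothesis, which may be any function `X → {-1, 1}`. A deterministic
algorithm is one all of whose output distributions are point masses. -/
abbrev Learner (X : Type*) (m : ℕ) : Type _ :=
  (Fin m → X × ℤˣ) → PMF (X → ℤˣ)

/-- The distribution of the hypothesis that the learner `A` outputs when it is given `m` i.i.d.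
samples from `D` together with their labels under `c`; the randomness is that of the sample and
that of `A`. -/
noncomputable def Learner.output {X : Type*} [Fintype X] {m : ℕ} (A : Learner X m) (D : PMF X)
    (c : X → ℤˣ) : PMF (X → ℤˣ) :=
  (iidSample D m).bind fun S => A fun i => (S i, c (S i))

/-! Let `C` consist of all labellings. It then suffices to find a set of order `d / γ²` points and
an `H` of VC-dimension at most `d` with advantage `γ` for every labelling and distribution: a
learner knows nothing about unseen points, and the usual no-free-lunch bounds follow.

Fix a large prime `p` and choose `k` with `p ^ k` of order `γ⁻²`. The domain is `d / 4` copies of a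
dense `Y ⊆ F_p ^ k`. A hypothesis chooses one affine hyperplane common to all copies and, in each
copy, a sign on it and a sign off it. The trace of a hyperplane on a finite set is determined by at
most `k + 1` of its points, and the signs add at most `d / 2` bits. Since `2 ^ (-d) < γ` makes `k`
small against `d`, the VC-dimension stays at most `d`.

For the advantage, every labelling of `Y` must be the sign, with large margin, of a combination,
with coefficients in `[-1, 1]`, of differences of indicators of parallel hyperplanes. These
differences form a matrix with orthogonal columns, so correlating a random labelling with its rows
gives coefficients that reproduce the labelling exactly. Truncating the coefficients at `τ` spoils
few points on average, by a fourth moment bound. Sauer–Shelah turns "many labellings, each off a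
small exceptional set" into "all labellings of one set `Y` of density at least `1/64`". Averaging
over the forms then yields a good hyperplane. For `γ` bounded below, `d` points with all hypotheses
suffice. -/

/-! ### Small sets and shattering -/

-- Weight each `B` by `16 ^ (n - #B)`. The total is `17 ^ n`, each counted set weighs at least `16 ^
-- (n - n / 32)`, and `17 ^ 8 ≤ 2 * 16 ^ 8`.
open Finset in
theorem card_small_sets_pow_le (X : Type*) [Fintype X] [DecidableEq X] :
    #{B : Finset X | 32 * #B ≤ Fintype.card X} ^ 4 ≤ 2 ^ Fintype.card X := by
  set n := Fintype.card X with hn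
  set c := #{B : Finset X | 32 * #B ≤ n} with hc
  have h17 : c * 16 ^ (n - n / 32) ≤ 17 ^ n := by
    have h := Fintype.sum_pow_mul_eq_add_pow X (1 : ℕ) 16
    rw [← hn] at h
    norm_num at h
    rw [← h, hc, ← smul_eq_mul, ← Finset.sum_const]
    refine (Finset.sum_le_sum fun B hB => ?_).trans
      (Finset.sum_le_sum_of_subset (Finset.subset_univ _))
    rw [Finset.mem_filter] at hB
    exact Nat.pow_le_pow_right (by norm_num) (by omega)
  have h8 : (c ^ 4) ^ 2 * 16 ^ (8 * n) ≤ (2 ^ n) ^ 2 * 16 ^ (8 * n) := by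
    calc (c ^ 4) ^ 2 * 16 ^ (8 * n)
        = (c * 16 ^ (n - n / 32)) ^ 8 * 16 ^ (8 * (n / 32)) := by
          rw [mul_pow, ← pow_mul, ← pow_mul, mul_assoc, ← pow_add]
          congr 2
          omega
      _ ≤ (17 ^ n) ^ 8 * 2 ^ n := by
          refine Nat.mul_le_mul (Nat.pow_le_pow_left h17 8) ?_
          rw [show (16 : ℕ) = 2 ^ 4 by norm_num, ← pow_mul]
          exact Nat.pow_le_pow_right (by norm_num) (by omega)
      _ = (17 ^ 8) ^ n * 2 ^ n := by rw [← pow_mul, ← pow_mul, mul_comm n 8]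
      _ ≤ (2 * 16 ^ 8) ^ n * 2 ^ n := by gcongr; norm_num
      _ = (2 ^ n) ^ 2 * 16 ^ (8 * n) := by rw [mul_pow, ← pow_mul]; ring
  exact (Nat.pow_le_pow_iff_left (by norm_num)).1 (Nat.le_of_mul_le_mul_right h8 (by positivity))

-- By Markov, half of the `A` have `#(B A) ≤ n / 64`. Pigeonhole gives one value `B₀` shared by more
-- such `A` than there are sets of size at most `n / 32`. By Pajor's form of Sauer–Shelah these `A`
-- shatter at least as many sets, hence one of size above `n / 32`; removing `B₀` leaves `n / 64`.
open Finset in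
theorem exists_shattered_avoiding {X : Type*} [Fintype X] [DecidableEq X]
    (B : Finset X → Finset X) (hX : 3 ≤ Fintype.card X)
    (hB : 128 * ∑ A, #(B A) ≤ Fintype.card X * 2 ^ Fintype.card X) :
    ∃ Y : Finset X, Fintype.card X ≤ 64 * #Y ∧
      ∀ t ⊆ Y, ∃ A, Disjoint Y (B A) ∧ Y ∩ A = t := by
  set n := Fintype.card X with hn
  set small : Finset (Finset X) := {B : Finset X | 32 * #B ≤ n} with hsmall
  have hc : #small ^ 4 ≤ 2 ^ n := card_small_sets_pow_le X
  set good : Finset (Finset X) := {A | 64 * #(B A) ≤ n} with hgood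
  have hbad : #({A | ¬ 64 * #(B A) ≤ n} : Finset (Finset X)) * n ≤ 64 * ∑ A, #(B A) := by
    rw [← smul_eq_mul, ← Finset.sum_const, Finset.mul_sum]
    refine (Finset.sum_le_sum fun A hA => ?_).trans
      (Finset.sum_le_sum_of_subset (Finset.subset_univ _))
    rw [Finset.mem_filter] at hA
    omega
  have htot : #good + #({A | ¬ 64 * #(B A) ≤ n} : Finset (Finset X)) = 2 ^ n := by
    rw [hgood, Finset.card_filter_add_card_filter_not, Finset.card_univ, Fintype.card_finset]
  have hgood2 : 2 ^ n ≤ 2 * #good := by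
    have : 2 * #({A | ¬ 64 * #(B A) ≤ n} : Finset (Finset X)) ≤ 2 ^ n := by
      refine Nat.le_of_mul_le_mul_left (c := n) ?_ (by omega)
      nlinarith
    omega
  have hlt : #small * #small < #good := by
    by_contra hcon
    push Not at hcon
    have h1 : 2 ^ n ≤ 2 * (#small * #small) := by omega
    have h2 : (2 ^ n) * 2 ^ n ≤ 4 * 2 ^ n := by
      calc (2 ^ n) * 2 ^ n ≤ (2 * (#small * #small)) * (2 * (#small * #small)) :=
            Nat.mul_le_mul h1 h1
        _ = 4 * #small ^ 4 := by ring
        _ ≤ 4 * 2 ^ n := by gcongr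
    have h3 := Nat.le_of_mul_le_mul_right h2 (by positivity)
    have h4 : 2 ^ 3 ≤ 2 ^ n := Nat.pow_le_pow_right (by norm_num) hX
    omega
  obtain ⟨B₀, -, hB₀⟩ := Finset.exists_lt_card_fiber_of_mul_lt_card_of_maps_to
    (f := B) (s := good) (t := small) (fun A hA => by
      simp only [hgood, hsmall, Finset.mem_filter, Finset.mem_univ, true_and] at hA ⊢
      omega) hlt
  have hsh := hB₀.trans_le (Finset.card_le_card_shatterer _)
  obtain ⟨Y₀, hY₀, hY₀s⟩ := Finset.exists_mem_notMem_of_card_lt_card hsh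
  rw [Finset.mem_shatterer] at hY₀
  have hY₀c : n < 32 * #Y₀ := by simpa [hsmall] using hY₀s
  have hB₀c : 64 * #B₀ ≤ n := by
    obtain ⟨A, hA⟩ := Finset.card_pos.1 (lt_of_le_of_lt (Nat.zero_le _) hB₀)
    simp only [hgood, Finset.mem_filter, Finset.mem_univ, true_and] at hA
    rw [← hA.2]; exact hA.1
  refine ⟨Y₀ \ B₀, ?_, fun t ht => ?_⟩
  · have := Finset.le_card_sdiff B₀ Y₀
    omega
  · obtain ⟨A, hA, hAt⟩ := hY₀ (ht.trans Finset.sdiff_subset)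
    simp only [Finset.mem_filter] at hA
    refine ⟨A, by rw [hA.2]; exact Finset.sdiff_disjoint, ?_⟩
    ext x
    have := Finset.ext_iff.1 hAt x
    simp only [Finset.mem_inter, Finset.mem_sdiff] at this ⊢
    constructor
    · rintro ⟨⟨h1, h2⟩, h3⟩; exact this.1 ⟨h1, h3⟩
    · intro h
      have h' := ht h
      rw [Finset.mem_sdiff] at h'
      exact ⟨h', (this.2 h).2⟩

/-- The sign vector of a finite set. -/
def signOf {X : Type*} [DecidableEq X] (A : Finset X) (x : X) : ℝ := if x ∈ A then 1 else -1

/-! ### Random signs and truncation -/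

section signOf
variable {X : Type*} [DecidableEq X]

theorem signOf_mul_self (A : Finset X) (x : X) : signOf A x * signOf A x = 1 := by
  unfold signOf; split_ifs <;> norm_num

theorem signOf_sq (A : Finset X) (x : X) : signOf A x ^ 2 = 1 := by
  rw [sq, signOf_mul_self]

theorem signOf_symmDiff_self (A : Finset X) (y : X) :
    signOf (symmDiff A {y}) y = - signOf A y := by
  unfold signOf; by_cases h : y ∈ A <;> simp [Finset.mem_symmDiff, h]

theorem signOf_symmDiff_of_ne (A : Finset X) {x y : X} (h : x ≠ y) :
    signOf (symmDiff A {y}) x = signOf A x := by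
  unfold signOf; simp [Finset.mem_symmDiff, h]

theorem sum_mul_signOf_eq_zero [Fintype X] (y : X) (G : Finset X → ℝ)
    (hG : ∀ A, G (symmDiff A {y}) = G A) : ∑ A, G A * signOf A y = 0 := by
  have hinv : Function.Involutive fun A : Finset X => symmDiff A {y} := fun A => by
    simp
  have h := Equiv.sum_comp (hinv.toPerm _) fun A => G A * signOf A y
  simp only [Function.Involutive.coe_toPerm, hG, signOf_symmDiff_self, mul_neg,
    Finset.sum_neg_distrib] at h
  linarith

/-- Khintchine's inequality for the fourth moment, by induction on `s`: flipping the sign at the new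
point cancels the odd terms. -/
theorem sum_signed_sum_moments [Fintype X] (a : X → ℝ) (s : Finset X) :
    ∑ A : Finset X, (∑ x ∈ s, a x * signOf A x) ^ 2 = 2 ^ Fintype.card X * ∑ x ∈ s, a x ^ 2 ∧
    ∑ A : Finset X, (∑ x ∈ s, a x * signOf A x) ^ 4 ≤
      3 * 2 ^ Fintype.card X * (∑ x ∈ s, a x ^ 2) ^ 2 := by
  induction s using Finset.induction_on with
  | empty => simp
  | insert y s hy ih =>
    obtain ⟨ih2, ih4⟩ := ih
    simp only [Finset.sum_insert hy]
    set S : Finset X → ℝ := fun A => ∑ x ∈ s, a x * signOf A x with hS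
    have hinv : ∀ A, S (symmDiff A {y}) = S A := fun A =>
      Finset.sum_congr rfl fun x hx => by
        rw [signOf_symmDiff_of_ne A (ne_of_mem_of_not_mem hx hy)]
    have hcard : ∑ _A : Finset X, (1 : ℝ) = 2 ^ Fintype.card X := by simp
    have o1 := sum_mul_signOf_eq_zero y (fun A => 2 * a y * S A) fun A => by simp only [hinv]
    have o2 := sum_mul_signOf_eq_zero y (fun A => 4 * a y ^ 3 * S A + 4 * a y * S A ^ 3)
      fun A => by simp only [hinv]
    have e2 : ∀ A, (a y * signOf A y + S A) ^ 2
        = S A ^ 2 + a y ^ 2 * 1 + 2 * a y * S A * signOf A y := fun A => by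
      linear_combination a y ^ 2 * signOf_sq A y
    have e4 : ∀ A, (a y * signOf A y + S A) ^ 4
        = S A ^ 4 + 6 * a y ^ 2 * S A ^ 2 + a y ^ 4 * 1
          + (4 * a y ^ 3 * S A + 4 * a y * S A ^ 3) * signOf A y := fun A => by
      linear_combination (a y ^ 4 * (signOf A y ^ 2 + 1) + 4 * a y ^ 3 * S A * signOf A y
        + 6 * a y ^ 2 * S A ^ 2) * signOf_sq A y
    change ∑ A, (a y * signOf A y + S A) ^ 2 = _ ∧ ∑ A, (a y * signOf A y + S A) ^ 4 ≤ _
    change ∑ A, S A ^ 2 = _ at ih2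
    change ∑ A, S A ^ 4 ≤ _ at ih4
    simp only [e2, e4, Finset.sum_add_distrib, o1, o2, ← Finset.mul_sum, ih2, hcard]
    refine ⟨by ring, ?_⟩
    have : (0 : ℝ) ≤ 2 ^ Fintype.card X * a y ^ 4 := by positivity
    nlinarith

end signOf

-- Here `Z` correlates the labelling `A` with the rows, `e` is the part of `Z` above the threshold,
-- and `y` is the error its removal causes. Orthogonality makes `Z` reproduce `V * signOf A`, so `(Z
-- - e) / τ` keeps half of the margin wherever `|y| ≤ V / 2`.
open Finset in
theorem exists_signs_realized_of_orthogonal {ι X : Type*} [Fintype ι] [Fintype X] [DecidableEq X]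
    (g : ι → X → ℝ) {V Q τ : ℝ} (hX : 3 ≤ Fintype.card X) (hV : 0 < V) (hτ : 0 < τ)
    (hg : ∀ x y, ∑ i, g i x * g i y = if x = y then V else 0)
    (hQ : ∑ i, (∑ x, g i x ^ 2) ^ 2 ≤ Q) (hτQ : 1536 * Q ≤ Fintype.card X * V * τ ^ 2) :
    ∃ Y : Finset X, Fintype.card X ≤ 64 * #Y ∧ ∀ t ⊆ Y, ∃ u : ι → ℝ, (∀ i, |u i| ≤ 1) ∧
      ∀ x ∈ Y, V / (2 * τ) ≤ (if x ∈ t then 1 else -1) * ∑ i, u i * g i x := by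
  set Z : Finset X → ι → ℝ := fun A i => ∑ x, g i x * signOf A x with hZ
  set e : Finset X → ι → ℝ := fun A i => if |Z A i| ≤ τ then 0 else Z A i with he
  set y : Finset X → X → ℝ := fun A x => ∑ i, e A i * g i x with hy
  have hMZ : ∀ A x, ∑ i, Z A i * g i x = V * signOf A x := fun A x => by
    simp only [hZ, Finset.sum_mul]
    rw [Finset.sum_comm]
    have : ∀ z, ∑ i, g i z * signOf A z * g i x = (if z = x then V else 0) * signOf A z :=
      fun z => by
        rw [← hg z x, Finset.sum_mul]
        exact Finset.sum_congr rfl fun i _ => by ring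
    simp [this]
  have hyy : ∀ A, ∑ x, y A x ^ 2 ≤ V * ∑ i, e A i ^ 2 := fun A => by
    have h1 : ∑ i, e A i * (∑ x, y A x * g i x) = ∑ x, y A x ^ 2 := by
      simp only [Finset.mul_sum]
      rw [Finset.sum_comm]
      refine Finset.sum_congr rfl fun x _ => ?_
      rw [sq]
      nth_rewrite 3 [hy]
      simp only [Finset.mul_sum]
      exact Finset.sum_congr rfl fun i _ => by ring
    have h2 : ∑ i, (∑ x, y A x * g i x) ^ 2 = V * ∑ x, y A x ^ 2 := by
      calc ∑ i, (∑ x, y A x * g i x) ^ 2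
          = ∑ x, ∑ z, y A x * y A z * ∑ i, g i x * g i z := by
            simp only [sq, Finset.sum_mul_sum]
            rw [Finset.sum_comm]
            refine Finset.sum_congr rfl fun x _ => ?_
            rw [Finset.sum_comm]
            refine Finset.sum_congr rfl fun z _ => ?_
            rw [Finset.mul_sum]
            exact Finset.sum_congr rfl fun i _ => by ring
        _ = V * ∑ x, y A x ^ 2 := by
            simp only [hg, mul_ite, mul_zero, Finset.sum_ite_eq, Finset.mem_univ, if_true]
            rw [Finset.mul_sum]
            exact Finset.sum_congr rfl fun x _ => by ring
    -- Bessel's inequality: up to scale, this is the squared distance from `e` to its projection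
    -- onto the span of the columns.
    have h3 : 0 ≤ ∑ i, (V * e A i - ∑ x, y A x * g i x) ^ 2 :=
      Finset.sum_nonneg fun i _ => sq_nonneg _
    have h4 : ∑ i, (V * e A i - ∑ x, y A x * g i x) ^ 2
        = V ^ 2 * ∑ i, e A i ^ 2 - 2 * V * ∑ i, e A i * (∑ x, y A x * g i x)
          + ∑ i, (∑ x, y A x * g i x) ^ 2 := by
      rw [Finset.mul_sum, Finset.mul_sum, ← Finset.sum_sub_distrib, ← Finset.sum_add_distrib]
      exact Finset.sum_congr rfl fun i _ => by ring
    rw [h4, h1, h2] at h3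
    refine le_of_mul_le_mul_left ?_ hV
    nlinarith
  have hee : ∑ A, ∑ i, e A i ^ 2 * τ ^ 2 ≤ 3 * 2 ^ Fintype.card X * Q := by
    rw [Finset.sum_comm]
    calc ∑ i, ∑ A, e A i ^ 2 * τ ^ 2
        ≤ ∑ i, 3 * 2 ^ Fintype.card X * (∑ x, g i x ^ 2) ^ 2 := by
          refine Finset.sum_le_sum fun i _ => ?_
          refine (Finset.sum_le_sum fun A _ => ?_).trans
            (sum_signed_sum_moments (g i) Finset.univ).2
          change e A i ^ 2 * τ ^ 2 ≤ Z A i ^ 4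
          simp only [he]
          split_ifs with h
          · simp; positivity
          · push Not at h
            have : τ ^ 2 ≤ Z A i ^ 2 := by
              rw [← sq_abs (Z A i)]; gcongr
            calc Z A i ^ 2 * τ ^ 2 ≤ Z A i ^ 2 * Z A i ^ 2 := by gcongr
              _ = Z A i ^ 4 := by ring
      _ ≤ _ := by rw [← Finset.mul_sum]; gcongr
  set B : Finset X → Finset X := fun A => {x | V / 2 < |y A x|} with hB
  have hBcard : ∀ A, (#(B A) : ℝ) * (V / 2) ^ 2 ≤ ∑ x, y A x ^ 2 := fun A => by
    rw [← nsmul_eq_mul, ← Finset.sum_const]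
    refine (Finset.sum_le_sum fun x hx => ?_).trans
      (Finset.sum_le_sum_of_subset_of_nonneg (Finset.subset_univ (B A)) fun x _ _ => sq_nonneg _)
    simp only [hB, Finset.mem_filter, Finset.mem_univ, true_and] at hx
    rw [← sq_abs (y A x)]
    gcongr
  have hBsum : 128 * ∑ A, #(B A) ≤ Fintype.card X * 2 ^ Fintype.card X := by
    have h1 : (∑ A, (#(B A) : ℝ)) * (V / 2) ^ 2 * τ ^ 2 ≤ V * (3 * 2 ^ Fintype.card X * Q) := by
      calc (∑ A, (#(B A) : ℝ)) * (V / 2) ^ 2 * τ ^ 2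
          ≤ (∑ A, V * ∑ i, e A i ^ 2) * τ ^ 2 := by
            rw [Finset.sum_mul]
            refine mul_le_mul_of_nonneg_right
              (Finset.sum_le_sum fun A _ => (hBcard A).trans (hyy A)) (by positivity)
        _ = V * ∑ A, ∑ i, e A i ^ 2 * τ ^ 2 := by
            rw [← Finset.mul_sum, mul_assoc, Finset.sum_mul]
            simp only [Finset.sum_mul]
        _ ≤ _ := by gcongr
    -- The constant is `1536 = 128 * 4 * 3`: density of bad points, the square of `V / 2`, and
    -- Khintchine.
    have h2 : (128 * ∑ A, (#(B A) : ℝ)) * (V ^ 2 * τ ^ 2)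
        ≤ (Fintype.card X * 2 ^ Fintype.card X) * (V ^ 2 * τ ^ 2) := by
      have h3 : V * 2 ^ Fintype.card X * (1536 * Q) ≤
          V * 2 ^ Fintype.card X * (Fintype.card X * V * τ ^ 2) := by gcongr
      nlinarith
    have h4 := le_of_mul_le_mul_right h2 (by positivity)
    exact_mod_cast h4
  obtain ⟨Y, hYc, hY⟩ := exists_shattered_avoiding B hX hBsum
  refine ⟨Y, hYc, fun t ht => ?_⟩
  obtain ⟨A, hdis, hA⟩ := hY t ht
  refine ⟨fun i => (Z A i - e A i) / τ, fun i => ?_, fun x hx => ?_⟩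
  · rw [abs_div, abs_of_pos hτ, div_le_one hτ]
    simp only [he]
    split_ifs with h
    · simpa using h
    · simpa using hτ.le
  · have hs : (if x ∈ t then (1 : ℝ) else -1) = signOf A x := by
      have : x ∈ t ↔ x ∈ A := by rw [← hA, Finset.mem_inter]; exact and_iff_right hx
      simp only [signOf, this]
    have hF : ∑ i, (Z A i - e A i) / τ * g i x = (V * signOf A x - y A x) / τ := by
      rw [← hMZ, hy, ← Finset.sum_sub_distrib, Finset.sum_div]
      exact Finset.sum_congr rfl fun i _ => by ring
    have hyx : |y A x| ≤ V / 2 := by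
      have : x ∉ B A := Finset.disjoint_left.1 hdis hx
      simpa [hB] using this
    rw [hs, hF, ← mul_div_assoc, mul_sub, div_le_div_iff₀ (by positivity) hτ]
    have h1 : |signOf A x * y A x| ≤ V / 2 := by
      rw [abs_mul]
      have : |signOf A x| = 1 := by unfold signOf; split_ifs <;> simp
      rwa [this, one_mul]
    have h2 := (abs_le.1 h1).2
    have h3 : signOf A x * (V * signOf A x) = V := by
      linear_combination V * signOf_mul_self A x
    rw [h3]
    nlinarith

/-! ### Orthogonality of hyperplane differences over a finite field -/

section AffineForms
variable {F : Type*} [Field F] {k : ℕ}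

/-- The value at `x` of the affine form with coefficients `r`. -/
def affineForm (r : (Fin k → F) × F) (x : Fin k → F) : F := r.1 ⬝ᵥ x + r.2

/-- The difference of the indicators of the parallel hyperplanes `r = 0` and `r = 1`. -/
def levelDiff [DecidableEq F] (a : F) : ℝ := (if a = 0 then 1 else 0) - (if a = 1 then 1 else 0)

/-- For `z ≠ 0` the value `w ⬝ᵥ z` is equidistributed, as shifting `w` along a coordinate where `z`
does not vanish shows. -/
theorem card_mul_sum_dotProduct_eq [Fintype F] (f : F → ℝ) (a : F) {z : Fin k → F} (hz : z ≠ 0) :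
    (Fintype.card F : ℝ) * ∑ w : Fin k → F, f (a + w ⬝ᵥ z)
      = (Fintype.card F : ℝ) ^ k * ∑ b, f b := by
  classical
  obtain ⟨i, hi⟩ : ∃ i, z i ≠ 0 := by
    by_contra h
    push Not at h
    exact hz (funext h)
  have hshift : ∀ b, ∑ w : Fin k → F, f (b + w ⬝ᵥ z) = ∑ w : Fin k → F, f (a + w ⬝ᵥ z) :=
    fun b => by
      refine Fintype.sum_equiv (Equiv.addRight (Pi.single i ((b - a) / z i))) _ _ fun w => ?_
      rw [Equiv.coe_addRight, add_dotProduct, single_dotProduct, div_mul_cancel₀ _ hi]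
      congr 1
      ring
  have h1 : ∑ b, ∑ w : Fin k → F, f (b + w ⬝ᵥ z)
      = (Fintype.card F : ℝ) ^ k * ∑ b, f b := by
    rw [Finset.sum_comm]
    have : ∀ w : Fin k → F, ∑ b, f (b + w ⬝ᵥ z) = ∑ b, f b := fun w =>
      Equiv.sum_comp (Equiv.addRight (w ⬝ᵥ z)) f
    simp [this]
  rw [← h1]
  simp [hshift]

theorem sum_levelDiff [Fintype F] [DecidableEq F] : ∑ a : F, levelDiff a = 0 := by
  simp [levelDiff]

theorem levelDiff_sq [DecidableEq F] (a : F) :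
    levelDiff a ^ 2 = (if a = 0 then 1 else 0) + (if a = 1 then 1 else 0) := by
  unfold levelDiff
  by_cases h0 : a = 0
  · subst h0; simp
  · by_cases h1 : a = 1 <;> simp [h0, h1]

theorem sum_levelDiff_sq [Fintype F] [DecidableEq F] : ∑ a : F, levelDiff a ^ 2 = 2 := by
  simp only [levelDiff_sq, Finset.sum_add_distrib]
  norm_num

/-- For `x ≠ y` the two values of a random affine form are independent and uniform, and `levelDiff`
has mean zero. This is why differences replace single indicators. -/
theorem sum_levelDiff_mul [Fintype F] [DecidableEq F] (x y : Fin k → F) :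
    ∑ r : (Fin k → F) × F, levelDiff (affineForm r x) * levelDiff (affineForm r y)
      = if x = y then 2 * (Fintype.card F : ℝ) ^ k else 0 := by
  rw [Fintype.sum_prod_type]
  have hshift : ∀ w : Fin k → F,
      ∑ a, levelDiff (affineForm (w, a) x) * levelDiff (affineForm (w, a) y)
        = ∑ a, levelDiff a * levelDiff (a + w ⬝ᵥ (y - x)) := fun w => by
    refine Fintype.sum_equiv (Equiv.addLeft (w ⬝ᵥ x)) _ _ fun a => ?_
    simp only [affineForm, Equiv.coe_addLeft, dotProduct_sub]
    congr 2
    ring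
  simp only [hshift]
  split_ifs with h
  · subst h
    simp only [sub_self, dotProduct_zero, add_zero, ← sq, sum_levelDiff_sq]
    simp [mul_comm]
  · rw [Finset.sum_comm]
    refine Finset.sum_eq_zero fun a _ => ?_
    rw [← Finset.mul_sum]
    have := card_mul_sum_dotProduct_eq levelDiff a (sub_ne_zero.2 (Ne.symm h))
    rw [sum_levelDiff, mul_zero] at this
    rw [(mul_eq_zero.1 this).resolve_left (by simp), mul_zero]

theorem sum_sum_levelDiff_sq_sq_le [Fintype F] [DecidableEq F] (hk : 1 ≤ k) :
    ∑ r : (Fin k → F) × F, (∑ x, levelDiff (affineForm r x) ^ 2) ^ 2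
      ≤ 6 * ((Fintype.card F : ℝ) ^ k) ^ 3 / Fintype.card F := by
  set q : ℝ := (Fintype.card F : ℝ) with hq
  have hq1 : 1 ≤ q := by
    rw [hq]; exact_mod_cast Fintype.card_pos
  have hn : q ≤ q ^ k := le_self_pow₀ hq1 (by omega)
  rw [Fintype.sum_prod_type]
  have hw : ∀ w : Fin k → F, ∑ a, (∑ x, levelDiff (affineForm (w, a) x) ^ 2) ^ 2
      ≤ 4 * (q ^ k) ^ 2 / q + if w = 0 then 2 * (q ^ k) ^ 2 else 0 := fun w => by
    split_ifs with h
    -- For `w = 0` the form is constant; only the constants `0` and `1` give a nonzero row, and that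
    -- row is full.
    · subst h
      have : ∀ a : F, (∑ x : Fin k → F, levelDiff (affineForm (0, a) x) ^ 2) ^ 2
          = (q ^ k) ^ 2 * levelDiff a ^ 2 := fun a => by
        have h2 : (levelDiff a ^ 2) ^ 2 = levelDiff a ^ 2 := by
          rw [levelDiff_sq]
          by_cases h0 : a = 0
          · subst h0; simp
          · by_cases h1 : a = 1 <;> simp [h0, h1]
        simp [affineForm, mul_pow, h2, hq]
      simp only [this, ← Finset.mul_sum, sum_levelDiff_sq]
      have : 0 ≤ 4 * (q ^ k) ^ 2 / q := by positivity
      linarith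
    · have : ∀ a : F, ∑ x : Fin k → F, levelDiff (affineForm (w, a) x) ^ 2 = q ^ k * 2 / q :=
        fun a => by
          have := card_mul_sum_dotProduct_eq (fun b : F => levelDiff b ^ 2) a h
          rw [sum_levelDiff_sq] at this
          rw [eq_div_iff (by positivity), mul_comm, ← this]
          simp only [affineForm, dotProduct_comm w, add_comm, hq]
      simp only [this, add_zero, Finset.sum_const, Finset.card_univ, nsmul_eq_mul, ← hq]
      apply le_of_eq
      field_simp
      ring
  refine (Finset.sum_le_sum fun w _ => hw w).trans ?_
  rw [Finset.sum_add_distrib]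
  simp only [Finset.sum_const, Finset.card_univ, Fintype.card_fun, Fintype.card_fin, nsmul_eq_mul,
    Finset.sum_ite_eq', Finset.mem_univ, if_true, Nat.cast_pow, ← hq]
  have h1 : 2 * (q ^ k) ^ 2 ≤ 2 * (q ^ k) ^ 3 / q := by
    rw [le_div_iff₀ (by positivity)]
    calc 2 * (q ^ k) ^ 2 * q ≤ 2 * (q ^ k) ^ 2 * q ^ k := by gcongr
      _ = _ := by ring
  calc q ^ k * (4 * (q ^ k) ^ 2 / q) + 2 * (q ^ k) ^ 2
      ≤ q ^ k * (4 * (q ^ k) ^ 2 / q) + 2 * (q ^ k) ^ 3 / q := by gcongr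
    _ = _ := by ring

open Finset in
theorem exists_signs_realized_by_affineForm [Fintype F] [DecidableEq F] (hk : 1 ≤ k)
    (hF : 3 ≤ Fintype.card F) {τ : ℝ} (hτ : 0 < τ)
    (hτ2 : 4608 * (Fintype.card F : ℝ) ^ k / Fintype.card F ≤ τ ^ 2) :
    ∃ Y : Finset (Fin k → F), Fintype.card F ^ k ≤ 64 * #Y ∧ ∀ t ⊆ Y,
      ∃ u : (Fin k → F) × F → ℝ, (∀ r, |u r| ≤ 1) ∧ ∀ x ∈ Y, (Fintype.card F : ℝ) ^ k / τ ≤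
        (if x ∈ t then 1 else -1) * ∑ r, u r * levelDiff (affineForm r x) := by
  have hq0 : (0 : ℝ) < Fintype.card F := by exact_mod_cast Fintype.card_pos
  have hcard : Fintype.card (Fin k → F) = Fintype.card F ^ k := by simp
  -- With these `V` and `Q` the threshold condition becomes `4608 = 1536 * 6 / 2`.
  obtain ⟨Y, hY, h⟩ := exists_signs_realized_of_orthogonal
    (fun r (x : Fin k → F) => levelDiff (affineForm r x)) (V := 2 * (Fintype.card F : ℝ) ^ k)
    (Q := 6 * ((Fintype.card F : ℝ) ^ k) ^ 3 / Fintype.card F) (τ := τ)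
    (by rw [hcard]; exact hF.trans (Nat.le_self_pow (by omega) _)) (by positivity) hτ
    sum_levelDiff_mul (sum_sum_levelDiff_sq_sq_le hk) (by
      rw [hcard]
      push_cast
      calc 1536 * (6 * ((Fintype.card F : ℝ) ^ k) ^ 3 / Fintype.card F)
          = 2 * ((Fintype.card F : ℝ) ^ k) ^ 2
              * (4608 * (Fintype.card F : ℝ) ^ k / Fintype.card F) := by ring
        _ ≤ 2 * ((Fintype.card F : ℝ) ^ k) ^ 2 * τ ^ 2 := by gcongr
        _ = _ := by ring)
  refine ⟨Y, by rwa [hcard] at hY, fun t ht => ?_⟩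
  obtain ⟨u, hu, hux⟩ := h t ht
  refine ⟨u, hu, fun x hx => ?_⟩
  have := hux x hx
  rwa [mul_div_mul_left _ _ (two_ne_zero)] at this

end AffineForms

/-! ### Loss as correlation -/

section Loss
variable {X : Type*} [Fintype X]

theorem loss_eq_sum (D : PMF X) (c h : X → ℤˣ) :
    loss D c h = ∑ x, if h x ≠ c x then (D x).toReal else 0 := by
  classical
  rw [loss, PMF.toOuterMeasure_apply_fintype, ENNReal.toReal_sum fun x _ => by
    rw [Set.indicator_apply]; split_ifs
    · exact D.apply_ne_top x
    · simp]
  refine Finset.sum_congr rfl fun x _ => ?_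
  rw [Set.indicator_apply]
  simp only [Set.mem_ofPred_eq]
  split_ifs <;> rfl

theorem PMF.sum_toReal (D : PMF X) : ∑ x, (D x).toReal = 1 := by
  have h : ∑ x, D x = 1 := by simpa [tsum_fintype] using D.tsum_coe
  rw [← ENNReal.toReal_sum fun x _ => D.apply_ne_top x, h, ENNReal.toReal_one]

theorem loss_eq_half_sub (D : PMF X) (c h : X → ℤˣ) :
    loss D c h = 1 / 2 - (∑ x, (D x).toReal * ((c x : ℤ) : ℝ) * ((h x : ℤ) : ℝ)) / 2 := by
  have : ∀ x, (if h x ≠ c x then (D x).toReal else 0)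
      = (D x).toReal / 2 - (D x).toReal * ((c x : ℤ) : ℝ) * ((h x : ℤ) : ℝ) / 2 := fun x => by
    rcases Int.units_eq_one_or (h x) with h1 | h1 <;>
    rcases Int.units_eq_one_or (c x) with h2 | h2 <;> rw [h1, h2] <;> simp <;> ring
  rw [loss_eq_sum, Finset.sum_congr rfl fun x _ => this x, Finset.sum_sub_distrib,
    ← Finset.sum_div, ← Finset.sum_div, D.sum_toReal]

end Loss

/-! ### VC-dimension and advantage of the hyperplane class -/

section HyperplaneClass
variable {F : Type*} [Field F] [DecidableEq F] {k : ℕ}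

/-- The hypotheses on `b` copies of `Y` that are constant, on each copy, on the trace of a common
affine hyperplane and on its complement. -/
def hyperplaneClass (b : ℕ) (Y : Finset (Fin k → F)) : Set (Fin b × Y → ℤˣ) :=
  Set.range fun (p : ((Fin k → F) × F) × (Fin b → ℤˣ) × (Fin b → ℤˣ)) z =>
    if affineForm p.1 z.2 = 0 then p.2.1 z.1 else p.2.2 z.1

-- A labelling of `T` is encoded by a spanning set of at most `k + 1` points of the hyperplane's
-- trace and by `2 * b` signs. If `#T > d`, shattering would force `3 * #T ≤ 8 * b`.
open Finset in
theorem vcDimension_hyperplaneClass_le {b d : ℕ} (Y : Finset (Fin k → F))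
    (hk : 32 * (k + 1) ≤ d + 1) (hb : 8 * b < 3 * (d + 1)) :
    vcDimension (hyperplaneClass b Y) ≤ d := by
  classical
  refine iSup₂_le fun T hT => ?_
  by_contra hcon
  rw [Nat.cast_le, not_le] at hcon
  have hreal : ∀ ℓ : T → ℤˣ, ∃ (r : (Fin k → F) × F) (s t : Fin b → ℤˣ), ∀ z : T,
      ℓ z = if affineForm r z.1.2 = 0 then s z.1.1 else t z.1.1 := fun ℓ => by
    obtain ⟨h, ⟨⟨r, s, t⟩, rfl⟩, hh⟩ := hT fun z => if hz : z ∈ T then ℓ ⟨z, hz⟩ else 1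
    refine ⟨r, s, t, fun z => ?_⟩
    have := hh z z.2
    simp only [Finset.coe_mem, dif_pos] at this
    exact this.symm
  choose r s t hrst using hreal
  -- Homogenizing makes affine forms linear on a space of dimension `k + 1`.
  set v : T → (Fin k → F) × F := fun z => (z.1.2, 1) with hv
  have hbasis : ∀ ℓ, ∃ B : Finset T, #B ≤ k + 1 ∧ ∀ z,
      affineForm (r ℓ) z.1.2 = 0 ↔ v z ∈ Submodule.span F (v '' B) := fun ℓ => by
    obtain ⟨B, hBt, -, hspan, hli⟩ := exists_linearIndepOn_extension
      (linearIndepOn_empty F v) (Set.empty_subset {z | affineForm (r ℓ) z.1.2 = 0})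
    refine ⟨B.toFinset, ?_, fun z => ?_⟩
    · have := LinearIndependent.fintype_card_le_finrank hli
      simpa [Set.toFinset_card] using this
    · rw [Set.coe_toFinset]
      refine ⟨fun hz => hspan ⟨z, hz, rfl⟩, fun hz => ?_⟩
      have : ∀ x ∈ Submodule.span F (v '' B), (r ℓ).1 ⬝ᵥ x.1 + (r ℓ).2 * x.2 = 0 := fun x hx => by
        induction hx using Submodule.span_induction with
        | mem x hx =>
          obtain ⟨y, hy, rfl⟩ := hx
          simpa [hv, affineForm] using hBt hy
        | zero => simp
        | add x y _ _ hx hy =>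
          rw [Prod.fst_add, Prod.snd_add, dotProduct_add]
          linear_combination hx + hy
        | smul a x _ hx =>
          rw [Prod.smul_fst, Prod.smul_snd, dotProduct_smul, smul_eq_mul, smul_eq_mul]
          linear_combination a * hx
      simpa [hv, affineForm] using this _ hz
  choose B hBc hB using hbasis
  have hcard : Fintype.card T = #T := Fintype.card_coe T
  let Φ : (T → ℤˣ) → {B : Finset T // 32 * #B ≤ Fintype.card T} × (Fin b → ℤˣ) × (Fin b → ℤˣ) :=
    fun ℓ => (⟨B ℓ, by have := hBc ℓ; omega⟩, s ℓ, t ℓ)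
  have hΦ : Function.Injective Φ := fun ℓ ℓ' h => by
    simp only [Φ, Prod.mk.injEq, Subtype.mk.injEq] at h
    obtain ⟨h1, h2, h3⟩ := h
    funext z
    rw [hrst ℓ z, hrst ℓ' z, h2, h3]
    simp only [hB, h1]
  have hle := Fintype.card_le_of_injective Φ hΦ
  have hsmall := card_small_sets_pow_le T
  rw [Fintype.card_prod, Fintype.card_prod, Fintype.card_subtype] at hle
  simp only [Fintype.card_fun, Fintype.card_units_int, Fintype.card_fin] at hle
  rw [hcard] at hle hsmall
  have h4 : 2 ^ (4 * #T) ≤ 2 ^ (#T + 8 * b) := by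
    calc 2 ^ (4 * #T) = (2 ^ #T) ^ 4 := by rw [← pow_mul, mul_comm]
      _ ≤ (#{B : Finset T | 32 * #B ≤ #T} * (2 ^ b * 2 ^ b)) ^ 4 := Nat.pow_le_pow_left hle 4
      _ = #{B : Finset T | 32 * #B ≤ #T} ^ 4 * 2 ^ (8 * b) := by ring
      _ ≤ 2 ^ #T * 2 ^ (8 * b) := by gcongr
      _ = _ := by rw [← pow_add]
  have := (Nat.pow_le_pow_iff_right (by norm_num)).1 h4
  omega

theorem exists_unit_mul_eq_abs (x : ℝ) : ∃ e : ℤˣ, ((e : ℤ) : ℝ) * x = |x| := by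
  rcases le_total 0 x with h | h
  · exact ⟨1, by simp [abs_of_nonneg h]⟩
  · exact ⟨-1, by simp [abs_of_nonpos h]⟩

/-- Average the margin over `D` and over the `q ^ (k + 1)` forms: some form has total correlation at
least `1 / (q * τ)`. The coefficients vary with the copy, but `|u| ≤ 1` bounds them away in favour
of absolute values, so one hyperplane with separate signs serves all copies. -/
theorem exists_hyperplaneClass_loss_le [Fintype F] {b : ℕ} {Y : Finset (Fin k → F)} {τ γ : ℝ}
    (hτ : 0 < τ)
    (hY : ∀ t ⊆ Y, ∃ u : (Fin k → F) × F → ℝ, (∀ r, |u r| ≤ 1) ∧ ∀ x ∈ Y,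
      (Fintype.card F : ℝ) ^ k / τ ≤
        (if x ∈ t then 1 else -1) * ∑ r, u r * levelDiff (affineForm r x))
    (hγ : 4 * (Fintype.card F * τ * γ) ≤ 1) (c : Fin b × Y → ℤˣ) (D : PMF (Fin b × Y)) :
    ∃ h ∈ hyperplaneClass b Y, loss D c h ≤ 1 / 2 - γ := by
  classical
  set q : ℝ := (Fintype.card F : ℝ) with hq
  have hq0 : 0 < q := by rw [hq]; exact_mod_cast Fintype.card_pos
  have hu : ∀ i : Fin b, ∃ u : (Fin k → F) × F → ℝ, (∀ r, |u r| ≤ 1) ∧ ∀ x : Y,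
      q ^ k / τ ≤ ((c (i, x) : ℤ) : ℝ) * ∑ r, u r * levelDiff (affineForm r x) := fun i => by
    obtain ⟨u, hu1, hu2⟩ := hY (Y.filter fun x => ∃ hx : x ∈ Y, c (i, ⟨x, hx⟩) = 1)
      (Finset.filter_subset _ _)
    refine ⟨u, hu1, fun x => ?_⟩
    have h := hu2 x x.2
    rcases Int.units_eq_one_or (c (i, x)) with h1 | h1
    · simpa [h1] using h
    · have h2 : ¬ ((-1 : ℤˣ) = 1) := by decide
      simpa [h1, h2] using h
  choose u hu1 hu2 using hu
  set w : Fin b × Y → ℝ := fun z => (D z).toReal * ((c z : ℤ) : ℝ) with hw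
  set P : (Fin k → F) × F → Fin b → ℝ := fun r i =>
    ∑ x : Y, if affineForm r x = 0 then w (i, x) else 0 with hP
  set P' : (Fin k → F) × F → Fin b → ℝ := fun r i =>
    ∑ x : Y, if affineForm r x = 0 then 0 else w (i, x) with hP'
  have hdiff : ∀ r i, ∑ x : Y, w (i, x) * levelDiff (affineForm r x)
      = P r i - P (r.1, r.2 - 1) i := fun r i => by
    rw [hP, ← Finset.sum_sub_distrib]
    refine Finset.sum_congr rfl fun x _ => ?_
    have : affineForm (r.1, r.2 - 1) (x : Fin k → F) = 0 ↔ affineForm r (x : Fin k → F) = 1 := by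
      simp only [affineForm]
      rw [← add_sub_assoc, sub_eq_zero]
    simp only [levelDiff, this, mul_sub, mul_ite, mul_one, mul_zero]
  have htotal : ∑ _r : (Fin k → F) × F, 1 / (q * τ)
      ≤ ∑ r, ∑ i, u i r * ∑ x : Y, w (i, x) * levelDiff (affineForm r x) := by
    calc ∑ _r : (Fin k → F) × F, 1 / (q * τ) = ∑ z, (D z).toReal * (q ^ k / τ) := by
          rw [← Finset.sum_mul, D.sum_toReal]
          simp only [Finset.sum_const, Finset.card_univ, Fintype.card_prod, Fintype.card_fun,
            Fintype.card_fin, nsmul_eq_mul, Nat.cast_mul, Nat.cast_pow, ← hq]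
          field_simp
      _ ≤ ∑ z : Fin b × Y, (D z).toReal *
            (((c z : ℤ) : ℝ) * ∑ r, u z.1 r * levelDiff (affineForm r z.2)) := by
          refine Finset.sum_le_sum fun z _ => ?_
          exact mul_le_mul_of_nonneg_left (hu2 z.1 z.2) ENNReal.toReal_nonneg
      _ = _ := by
          rw [Fintype.sum_prod_type, Finset.sum_comm (s := (Finset.univ : Finset ((Fin k → F) × F)))]
          refine Finset.sum_congr rfl fun i _ => ?_
          simp only [Finset.mul_sum]
          rw [Finset.sum_comm]
          refine Finset.sum_congr rfl fun r _ => Finset.sum_congr rfl fun x _ => ?_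
          simp only [hw]
          ring
  obtain ⟨r, -, hr⟩ := Finset.exists_le_of_sum_le Finset.univ_nonempty htotal
  have hr2 : 1 / (q * τ) ≤ ∑ i, |P r i| + ∑ i, |P (r.1, r.2 - 1) i| := by
    refine hr.trans ?_
    rw [← Finset.sum_add_distrib]
    refine Finset.sum_le_sum fun i _ => ?_
    rw [hdiff]
    refine (le_abs_self _).trans ?_
    rw [abs_mul]
    exact (mul_le_of_le_one_left (abs_nonneg _) (hu1 i r)).trans (abs_sub _ _)
  -- One of the two parallel hyperplanes carries at least half.
  obtain ⟨ρ, hρ⟩ : ∃ ρ, 1 / (2 * (q * τ)) ≤ ∑ i, |P ρ i| := by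
    by_contra hcon
    push Not at hcon
    have h1 := hcon r
    have h2 := hcon (r.1, r.2 - 1)
    have h3 : 1 / (q * τ) = 1 / (2 * (q * τ)) + 1 / (2 * (q * τ)) := by field_simp; norm_num
    linarith
  choose s hs using fun i => exists_unit_mul_eq_abs (P ρ i)
  choose t ht using fun i => exists_unit_mul_eq_abs (P' ρ i)
  refine ⟨_, ⟨(ρ, s, t), rfl⟩, ?_⟩
  rw [loss_eq_half_sub]
  have hsum : ∑ z : Fin b × Y, (D z).toReal * ((c z : ℤ) : ℝ)
      * (((if affineForm ρ (z.2 : Fin k → F) = 0 then s z.1 else t z.1 : ℤˣ) : ℤ) : ℝ)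
      = ∑ i, |P ρ i| + ∑ i, |P' ρ i| := by
    rw [Fintype.sum_prod_type, ← Finset.sum_add_distrib]
    refine Finset.sum_congr rfl fun i _ => ?_
    rw [← hs, ← ht, hP, hP', Finset.mul_sum, Finset.mul_sum, ← Finset.sum_add_distrib]
    refine Finset.sum_congr rfl fun x _ => ?_
    simp only [hw]
    split_ifs <;> ring
  simp only [] at hsum ⊢
  rw [hsum]
  have h0 : 0 ≤ ∑ i, |P' ρ i| := Finset.sum_nonneg fun i _ => abs_nonneg _
  have h1 : 2 * γ ≤ 1 / (2 * (q * τ)) := by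
    rw [le_div_iff₀ (by positivity)]
    linarith
  linarith

end HyperplaneClass

/-! ### Choice of parameters -/

theorem vcDimension_le_card {X : Type*} [Fintype X] (H : Set (X → ℤˣ)) :
    vcDimension H ≤ Fintype.card X :=
  iSup₂_le fun T _ => by exact_mod_cast T.card_le_univ

theorem exists_weakly_learnable_univ :
    ∃ κ : ℝ, 0 < κ ∧ ∀ (d : ℕ) (γ : ℝ), (2 : ℝ) ^ (-(d : ℤ)) < γ → γ < 1 / 80 →
      ∃ (X : Type) (_ : Fintype X) (H : Set (X → ℤˣ)), vcDimension H ≤ d ∧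
        (∀ (c : X → ℤˣ) (D : PMF X), ∃ h ∈ H, loss D c h ≤ 1 / 2 - γ) ∧
        2 ≤ Fintype.card X ∧ κ * (d * γ ^ (-2 : ℤ)) ≤ Fintype.card X := by
  -- With `p ≥ 2 ^ 128`, the bounds `p ^ k ≤ γ⁻² < 2 ^ (2 * d)` will give `64 * k < d`.
  obtain ⟨p, hp, hpp⟩ := Nat.exists_infinite_primes (2 ^ 128)
  have : Fact p.Prime := ⟨hpp⟩
  have hq : (2 : ℝ) ^ 128 ≤ p := by exact_mod_cast hp
  have hq0 : (0 : ℝ) < p := lt_of_lt_of_le (by positivity) hq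
  have hq1 : (1 : ℝ) < p := lt_of_lt_of_le (by norm_num) hq
  have hF : Fintype.card (ZMod p) = p := ZMod.card p
  refine ⟨1 / (512 * (73728 * p) * p), by positivity, fun d γ hdγ hγ => ?_⟩
  have hγ0 : 0 < γ := lt_trans (by positivity) hdγ
  have hd0 : d ≠ 0 := by
    rintro rfl
    norm_num at hdγ
    linarith
  have hzpow : γ ^ (-2 : ℤ) = 1 / γ ^ 2 := by
    rw [zpow_neg, one_div]; norm_cast
  have h4d : 1 / γ ^ 2 < 2 ^ (2 * d) := by
    rw [zpow_neg, zpow_natCast] at hdγ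
    rw [div_lt_iff₀ (by positivity), mul_comm 2 d, pow_mul, ← mul_pow]
    refine one_lt_pow₀ ?_ two_ne_zero
    rwa [mul_comm, ← div_lt_iff₀ (by positivity), one_div]
  -- Here `73728 = 16 * 4608` comes from squaring `4 * p * τ * γ ≤ 1`. In the first case `γ⁻²` is
  -- bounded by a constant.
  rcases lt_or_ge (1 / (73728 * (p : ℝ) * γ ^ 2)) (p : ℝ) with hsmall | hlarge
  · have hd2 : 2 ≤ d := by
      by_contra h
      have : d = 1 := by omega
      subst this
      norm_num at hdγ
      linarith
    refine ⟨Fin d, inferInstance, Set.univ, ?_, fun c D => ⟨c, Set.mem_univ _, ?_⟩, ?_, ?_⟩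
    · simpa using vcDimension_le_card (Set.univ : Set (Fin d → ℤˣ))
    · rw [loss_eq_sum]
      simp
      linarith
    · simpa using hd2
    · rw [hzpow, Fintype.card_fin]
      rw [div_lt_iff₀ (by positivity)] at hsmall
      have hd : (0 : ℝ) ≤ d := Nat.cast_nonneg d
      calc 1 / (512 * (73728 * p) * p) * (d * (1 / γ ^ 2))
          = (d : ℝ) * (1 / (512 * (p * (73728 * (p : ℝ) * γ ^ 2)))) := by field_simp
        _ ≤ (d : ℝ) * 1 := by
          refine mul_le_mul_of_nonneg_left ?_ hd
          rw [div_le_one (by positivity)]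
          linarith
        _ = (d : ℝ) := mul_one _
  · obtain ⟨k, hk1, hk2⟩ := exists_nat_pow_near (hq1.le.trans hlarge) hq1
    have hk : 1 ≤ k := by
      by_contra h
      have : k = 0 := by omega
      subst this
      rw [zero_add, pow_one] at hk2
      linarith
    have hkd : 64 * k < d := by
      have h1 : (2 : ℝ) ^ (128 * k) < 2 ^ (2 * d) := by
        calc (2 : ℝ) ^ (128 * k) = (2 ^ 128) ^ k := by rw [pow_mul]
          _ ≤ (p : ℝ) ^ k := by gcongr
          _ ≤ 1 / (73728 * p * γ ^ 2) := hk1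
          _ ≤ 1 / γ ^ 2 := by
              apply one_div_le_one_div_of_le (by positivity)
              nlinarith [sq_nonneg γ]
          _ < _ := h4d
      have := (pow_lt_pow_iff_right₀ (one_lt_two)).1 h1
      omega
    set τ : ℝ := √(4608 * (p : ℝ) ^ k / p) with hτ
    have hτ2 : τ ^ 2 = 4608 * (p : ℝ) ^ k / p := Real.sq_sqrt (by positivity)
    have hτ0 : 0 < τ := Real.sqrt_pos.2 (by positivity)
    obtain ⟨Y, hYc, hY⟩ := exists_signs_realized_by_affineForm (F := ZMod p) hk
      (by rw [hF]; omega) hτ0 (by rw [hF, hτ2])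
    rw [hF] at hYc
    have hγτ : 4 * ((Fintype.card (ZMod p) : ℝ) * τ * γ) ≤ 1 := by
      rw [hF]
      rw [le_div_iff₀ (by positivity)] at hk1
      refine (sq_le_sq₀ (by positivity) zero_le_one).1 ?_
      calc (4 * ((p : ℝ) * τ * γ)) ^ 2 = 16 * p ^ 2 * τ ^ 2 * γ ^ 2 := by ring
        _ = p ^ k * (73728 * p * γ ^ 2) := by rw [hτ2]; field_simp; norm_num
        _ ≤ 1 ^ 2 := by rwa [one_pow]
    have hYpos : 1 ≤ Y.card := by
      have := Nat.pos_of_ne_zero (pow_ne_zero k hpp.ne_zero)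
      omega
    refine ⟨Fin (d / 4) × Y, inferInstance, hyperplaneClass (d / 4) Y,
      vcDimension_hyperplaneClass_le Y (by omega) (by omega),
      exists_hyperplaneClass_loss_le hτ0 hY hγτ, ?_, ?_⟩
    · rw [Fintype.card_prod, Fintype.card_fin, Fintype.card_coe]
      exact Nat.mul_le_mul (show 2 ≤ d / 4 by omega) hYpos
    · rw [Fintype.card_prod, Fintype.card_fin, Fintype.card_coe, hzpow]
      push_cast
      have hb : (d : ℝ) / 8 ≤ ((d / 4 : ℕ) : ℝ) := by
        rw [div_le_iff₀ (by norm_num)]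
        exact_mod_cast (show d ≤ d / 4 * 8 by omega)
      have hYr : 1 / (73728 * p * γ ^ 2) / p / 64 ≤ (Y.card : ℝ) := by
        rw [div_le_iff₀ (by norm_num), div_le_iff₀ hq0]
        have h1 : (p : ℝ) ^ k ≤ 64 * Y.card := by exact_mod_cast hYc
        calc 1 / (73728 * p * γ ^ 2) ≤ (p : ℝ) ^ k * p := by rw [← pow_succ]; exact hk2.le
          _ ≤ 64 * Y.card * p := by gcongr
          _ = _ := by ring
      calc 1 / (512 * (73728 * p) * p) * (d * (1 / γ ^ 2))
          = (d : ℝ) / 8 * (1 / (73728 * p * γ ^ 2) / p / 64) := by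
            field_simp; norm_num
        _ ≤ _ := by gcongr

/-! ### Lower bounds from unseen mass -/

section LowerBound
variable {X : Type*} [Fintype X]

-- Flipping `c` off the sample leaves the learner's input unchanged, and the losses against `c` and
-- its flip add up to at least the unseen mass. So, averaged over `c`, the learner fails with
-- probability at least `1/2` on each sample in `E`.
open scoped Classical in
theorem exists_concept_of_unseen_mass {m : ℕ} (D : PMF X) (A : Learner X m) {θ δ : ℝ}
    (E : Finset (Fin m → X))
    (hE : ∀ S ∈ E, 2 * θ ≤ ∑ x, if x ∈ Set.range S then 0 else (D x).toReal)
    (hP : 2 * δ ≤ ∑ S ∈ E, ∏ i, (D (S i)).toReal) :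
    ∃ c : X → ℤˣ, ENNReal.ofReal δ ≤ (A.output D c).toOuterMeasure {h | θ ≤ loss D c h} := by
  set μ : (Fin m → X) → (X → ℤˣ) → ENNReal := fun S c =>
    (A fun i => (S i, c (S i))).toOuterMeasure {h | θ ≤ loss D c h} with hμ
  have hpair : ∀ S ∈ E, (Fintype.card (X → ℤˣ) : ENNReal) ≤ 2 * ∑ c, μ S c := fun S hS => by
    let flip : (X → ℤˣ) → X → ℤˣ := fun c x => if x ∈ Set.range S then c x else - c x
    have hflip : Function.Involutive flip := fun c => by
      funext x
      by_cases hx : x ∈ Set.range S <;> simp only [flip, hx, if_true, if_false, neg_neg]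
    have hone : ∀ c, 1 ≤ μ S c + μ S (flip c) := fun c => by
      have hseen : (fun i => (S i, flip c (S i))) = fun i => (S i, c (S i)) := by
        funext i
        simp [flip]
      have hcover : ∀ h, θ ≤ loss D c h ∨ θ ≤ loss D (flip c) h := fun h => by
        by_contra hcon
        push Not at hcon
        have hsum : ∑ x, (if x ∈ Set.range S then 0 else (D x).toReal)
            ≤ loss D c h + loss D (flip c) h := by
          rw [loss_eq_sum, loss_eq_sum, ← Finset.sum_add_distrib]
          refine Finset.sum_le_sum fun x _ => ?_
          have h0 : 0 ≤ (D x).toReal := ENNReal.toReal_nonneg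
          by_cases hx : x ∈ Set.range S
          · rw [if_pos hx]
            exact add_nonneg (by split_ifs <;> simp) (by split_ifs <;> simp)
          · simp only [flip, hx, if_false]
            by_cases hc : h x = c x
            · simp [hc]
            · rw [if_pos hc]
              exact le_add_of_nonneg_right (by split_ifs <;> simp)
        linarith [hE S hS]
      simp only [hμ, hseen]
      refine le_trans ?_ (MeasureTheory.measure_union_le (μ := PMF.toOuterMeasure _) _ _)
      rw [show {h | θ ≤ loss D c h} ∪ {h | θ ≤ loss D (flip c) h} = Set.univ from
        Set.eq_univ_of_forall hcover]
      exact ((PMF.toOuterMeasure_apply_eq_one_iff _ _).2 (Set.subset_univ _)).ge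
    have hsum := Equiv.sum_comp (hflip.toPerm flip) (μ S)
    rw [Function.Involutive.coe_toPerm] at hsum
    calc (Fintype.card (X → ℤˣ) : ENNReal) = ∑ _c : X → ℤˣ, 1 := by simp
      _ ≤ ∑ c, (μ S c + μ S (flip c)) := Finset.sum_le_sum fun c _ => hone c
      _ = 2 * ∑ c, μ S c := by rw [Finset.sum_add_distrib, hsum, two_mul]
  have hP' : 2 * ENNReal.ofReal δ ≤ ∑ S ∈ E, iidSample D m S := by
    have : ∑ S ∈ E, iidSample D m S = ENNReal.ofReal (∑ S ∈ E, ∏ i, (D (S i)).toReal) := by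
      rw [ENNReal.ofReal_sum_of_nonneg fun S _ =>
        Finset.prod_nonneg fun i _ => ENNReal.toReal_nonneg]
      refine Finset.sum_congr rfl fun S _ => ?_
      rw [iidSample, PMF.ofFintype_apply,
        ENNReal.ofReal_prod_of_nonneg fun i _ => ENNReal.toReal_nonneg]
      exact Finset.prod_congr rfl fun i _ => (ENNReal.ofReal_toReal (D.apply_ne_top _)).symm
    rw [this, show (2 : ENNReal) = ENNReal.ofReal 2 by simp, ← ENNReal.ofReal_mul two_pos.le]
    exact ENNReal.ofReal_le_ofReal hP
  have hout : ∀ c, ∑ S ∈ E, iidSample D m S * μ S c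
      ≤ (A.output D c).toOuterMeasure {h | θ ≤ loss D c h} := fun c => by
    rw [Learner.output, PMF.toOuterMeasure_bind_apply]
    exact ENNReal.sum_le_tsum E
  by_contra hcon
  push Not at hcon
  have hlt : ∑ c : X → ℤˣ, ∑ S ∈ E, iidSample D m S * μ S c
      < ∑ _c : X → ℤˣ, ENNReal.ofReal δ :=
    ENNReal.sum_lt_sum_of_nonempty Finset.univ_nonempty fun c _ => (hout c).trans_lt (hcon c)
  rw [Finset.sum_comm] at hlt
  simp only [← Finset.mul_sum, Finset.sum_const, Finset.card_univ, nsmul_eq_mul] at hlt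
  have hge : 2 * (Fintype.card (X → ℤˣ) * ENNReal.ofReal δ)
      ≤ 2 * ∑ S ∈ E, iidSample D m S * ∑ c, μ S c := by
    calc 2 * (Fintype.card (X → ℤˣ) * ENNReal.ofReal δ)
        = (2 * ENNReal.ofReal δ) * Fintype.card (X → ℤˣ) := by ring
      _ ≤ (∑ S ∈ E, iidSample D m S) * Fintype.card (X → ℤˣ) := by gcongr
      _ = ∑ S ∈ E, iidSample D m S * Fintype.card (X → ℤˣ) := Finset.sum_mul _ _ _
      _ ≤ ∑ S ∈ E, iidSample D m S * (2 * ∑ c, μ S c) :=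
          Finset.sum_le_sum fun S hS => by gcongr; exact hpair S hS
      _ = _ := by
          rw [Finset.mul_sum]
          exact Finset.sum_congr rfl fun S _ => by ring
  rw [ENNReal.mul_le_mul_iff_right two_ne_zero ENNReal.ofNat_ne_top] at hge
  exact absurd hlt hge.not_gt

open scoped Classical in
theorem exists_spike_distribution (x₀ : X) (hX : 2 ≤ Fintype.card X) {ε : ℝ} (hε0 : 0 ≤ ε)
    (hε1 : ε ≤ 1) : ∃ D : PMF X, ∀ x, (D x).toReal =
      if x = x₀ then 1 - ε else ε / ((Fintype.card X : ℝ) - 1) := by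
  have hL : (0 : ℝ) < (Fintype.card X : ℝ) - 1 := by
    have : (2 : ℝ) ≤ Fintype.card X := by exact_mod_cast hX
    linarith
  have hnn : ∀ x, 0 ≤ if x = x₀ then 1 - ε else ε / ((Fintype.card X : ℝ) - 1) := fun x => by
    split_ifs
    · linarith
    · positivity
  refine ⟨PMF.ofFintype (fun x => ENNReal.ofReal
    (if x = x₀ then 1 - ε else ε / ((Fintype.card X : ℝ) - 1))) ?_, fun x => ?_⟩
  · rw [← ENNReal.ofReal_sum_of_nonneg fun x _ => hnn x, Fintype.sum_eq_add_sum_compl x₀,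
      if_pos rfl, Finset.sum_congr rfl fun x hx => if_neg (by simpa using hx), Finset.sum_const,
      Finset.card_compl, Finset.card_singleton, nsmul_eq_mul, Nat.cast_sub (by omega),
      Nat.cast_one, mul_div_cancel₀ _ hL.ne']
    simp
  · rw [PMF.ofFintype_apply, ENNReal.toReal_ofReal (hnn x)]

theorem sum_prod_mul_apply {m : ℕ} {w : X → ℝ} (hw : ∑ x, w x = 1) (f : X → ℝ) (j : Fin m) :
    ∑ S : Fin m → X, (∏ i, w (S i)) * f (S j) = ∑ x, w x * f x := by
  classical
  have h : ∀ S : Fin m → X, (∏ i, w (S i)) * f (S j)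
      = ∏ i, w (S i) * (if i = j then f (S i) else 1) := fun S => by
    rw [Finset.prod_mul_distrib]
    simp
  simp only [h]
  rw [← Fintype.prod_sum fun (i : Fin m) x => w x * if i = j then f x else 1,
    Finset.prod_eq_single j]
  · simp
  · intro i _ hi
    simp [hi, hw]
  · simp

end LowerBound

section LowerBound
variable {X : Type*} [Fintype X]

/-- Spread mass `ε` evenly off a heavy point. The expected number of light draws is `m * ε ≤ L / 6`,
so by Markov at least half of the light mass is unseen with probability at least `2/3`, which
exceeds `2 * δ`. -/
theorem exists_distribution_loss_ge_card (hX : 2 ≤ Fintype.card X) {m : ℕ} (hm : 1 ≤ m) {δ : ℝ}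
    (hδ : δ < 1 / 3) : ∃ D : PMF X, ∀ A : Learner X m, ∃ c : X → ℤˣ,
      ENNReal.ofReal δ ≤ (A.output D c).toOuterMeasure
        {h | 1 / 4 * min 1 (((Fintype.card X : ℝ) - 1) / (6 * m)) ≤ loss D c h} := by
  classical
  set L : ℝ := (Fintype.card X : ℝ) - 1 with hL
  have hL0 : 0 < L := by
    have : (2 : ℝ) ≤ Fintype.card X := by exact_mod_cast hX
    rw [hL]; linarith
  have hm0 : (0 : ℝ) < m := by exact_mod_cast hm
  set ε : ℝ := min 1 (L / (6 * m)) with hε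
  have hε0 : 0 < ε := lt_min one_pos (by positivity)
  have hεm : 6 * (m * ε) ≤ L := by
    have : ε ≤ L / (6 * m) := min_le_right _ _
    rw [le_div_iff₀ (by positivity)] at this
    linarith
  obtain ⟨x₀⟩ : Nonempty X := Fintype.card_pos_iff.1 (by omega)
  obtain ⟨D, hD⟩ := exists_spike_distribution x₀ hX hε0.le (min_le_left _ _)
  set out : (Fin m → X) → ℝ := fun S => ∑ i, if S i = x₀ then 0 else 1 with hout
  refine ⟨D, fun A => exists_concept_of_unseen_mass D A
    (Finset.univ.filter fun S => 2 * out S ≤ L) (fun S hS => ?_) ?_⟩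
  · rw [Finset.mem_filter] at hS
    have h1 : ∀ x, (if x = x₀ then 0 else ε / L) - (if x = x₀ then 0 else if x ∈ Set.range S
        then ε / L else 0) ≤ if x ∈ Set.range S then 0 else (D x).toReal := fun x => by
      have h0 : 0 ≤ (D x).toReal := ENNReal.toReal_nonneg
      by_cases hx : x = x₀
      · simp only [hx, if_true, sub_self]
        split_ifs
        · rfl
        · exact ENNReal.toReal_nonneg
      · rw [hD]
        simp only [hx, if_false]
        split_ifs <;> simp [hL]
    refine le_trans ?_ (Finset.sum_le_sum fun x _ => h1 x)
    rw [Finset.sum_sub_distrib]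
    have h2 : ∑ x, (if x = x₀ then 0 else ε / L) = ε := by
      rw [Fintype.sum_eq_add_sum_compl x₀, if_pos rfl,
        Finset.sum_congr rfl fun x hx => if_neg (by simpa using hx), Finset.sum_const,
        Finset.card_compl, Finset.card_singleton, nsmul_eq_mul, Nat.cast_sub (by omega),
        Nat.cast_one, mul_div_cancel₀ _ hL0.ne', zero_add]
    have h3 : ∑ x, (if x = x₀ then 0 else if x ∈ Set.range S then ε / L else 0)
        ≤ out S * (ε / L) := by
      have : ∀ x, (if x = x₀ then 0 else if x ∈ Set.range S then ε / L else 0)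
          ≤ ∑ i, if S i = x then (if x = x₀ then 0 else ε / L) else 0 := fun x => by
        have hnn : ∀ i, 0 ≤ if S i = x then (if x = x₀ then 0 else ε / L) else 0 := fun i => by
          split_ifs <;> positivity
        by_cases hx : x ∈ Set.range S
        · obtain ⟨i, hi⟩ := hx
          refine le_trans ?_ (Finset.single_le_sum (fun i _ => hnn i) (Finset.mem_univ i))
          simp [← hi]
        · simp only [hx, if_false, ite_self]
          exact Finset.sum_nonneg fun i _ => hnn i
      refine (Finset.sum_le_sum fun x _ => this x).trans ?_
      rw [Finset.sum_comm, hout, Finset.sum_mul]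
      refine Finset.sum_le_sum fun i _ => ?_
      simp
    have h4 : out S * (ε / L) ≤ ε / 2 := by
      calc out S * (ε / L) ≤ L / 2 * (ε / L) := by
            gcongr
            linarith [hS.2]
        _ = ε / 2 := by field_simp
    rw [h2]
    linarith
  · set P : (Fin m → X) → ℝ := fun S => ∏ i, (D (S i)).toReal with hP
    have hP0 : ∀ S, 0 ≤ P S := fun S => Finset.prod_nonneg fun i _ => ENNReal.toReal_nonneg
    have h1 : ∑ S, P S = 1 := by
      have := sum_prod_mul_apply (m := m) D.sum_toReal (fun _ => 1) ⟨0, hm⟩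
      simpa [D.sum_toReal] using this
    have h2 : ∑ S, P S * out S = m * ε := by
      simp only [hout, Finset.mul_sum]
      rw [Finset.sum_comm]
      have : ∀ j : Fin m, ∑ S : Fin m → X, P S * (if S j = x₀ then 0 else 1) = ε := fun j => by
        rw [sum_prod_mul_apply D.sum_toReal (fun x => if x = x₀ then 0 else 1) j]
        have h3 := D.sum_toReal
        rw [Fintype.sum_eq_add_sum_compl x₀, hD x₀, if_pos rfl] at h3
        rw [Fintype.sum_eq_add_sum_compl x₀, if_pos rfl,
          Finset.sum_congr rfl fun x hx => by rw [if_neg (by simpa using hx), mul_one]]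
        linarith
      rw [Finset.sum_congr rfl fun j _ => this j]
      simp
    have h3 : ∑ S ∈ Finset.univ.filter (fun S => ¬ 2 * out S ≤ L), P S * L ≤ 2 * (m * ε) := by
      rw [← h2, Finset.mul_sum]
      refine (Finset.sum_le_sum (g := fun S => 2 * (P S * out S)) fun S hS => ?_).trans
        (Finset.sum_le_sum_of_subset_of_nonneg (Finset.subset_univ _) fun S _ _ => ?_)
      · rw [Finset.mem_filter, not_le] at hS
        nlinarith [hP0 S, hS.2]
      · have : 0 ≤ out S := Finset.sum_nonneg fun i _ => by split_ifs <;> norm_num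
        have := hP0 S
        positivity
    have h4 := Finset.sum_filter_add_sum_filter_not Finset.univ (fun S => 2 * out S ≤ L) P
    rw [h1] at h4
    rw [← Finset.sum_mul] at h3
    have h5 : ∑ S ∈ Finset.univ.filter (fun S => ¬ 2 * out S ≤ L), P S ≤ 1 / 3 := by
      refine le_of_mul_le_mul_right ?_ hL0
      linarith
    linarith

/-- The whole sample sits at the heavy point with probability `(1 - ε) ^ m ≥ exp (-2 * ε * m) ≥ √δ`,
and `√δ ≥ 2 * δ` exactly because `δ ≤ 1 / 4`. -/
theorem exists_distribution_loss_ge_log (hX : 2 ≤ Fintype.card X) {m : ℕ} (hm : 1 ≤ m) {δ : ℝ}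
    (hδ0 : 0 < δ) (hδ : δ ≤ 1 / 4) : ∃ D : PMF X, ∀ A : Learner X m, ∃ c : X → ℤˣ,
      ENNReal.ofReal δ ≤ (A.output D c).toOuterMeasure
        {h | 1 / 2 * min (1 / 2) (Real.log (1 / δ) / (4 * m)) ≤ loss D c h} := by
  classical
  have hm0 : (0 : ℝ) < m := by exact_mod_cast hm
  have hlog : 0 < Real.log (1 / δ) := Real.log_pos (by rw [lt_div_iff₀ hδ0]; linarith)
  set ε : ℝ := min (1 / 2) (Real.log (1 / δ) / (4 * m)) with hε
  have hε0 : 0 < ε := lt_min (by norm_num) (by positivity)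
  have hε1 : ε ≤ 1 / 2 := min_le_left _ _
  have hεm : 2 * ε * m ≤ Real.log (1 / δ) / 2 := by
    have : ε ≤ Real.log (1 / δ) / (4 * m) := min_le_right _ _
    rw [le_div_iff₀ (by positivity)] at this
    linarith
  obtain ⟨x₀⟩ : Nonempty X := Fintype.card_pos_iff.1 (by omega)
  obtain ⟨D, hD⟩ := exists_spike_distribution x₀ hX hε0.le (by linarith)
  refine ⟨D, fun A => exists_concept_of_unseen_mass D A {fun _ => x₀} (fun S hS => ?_) ?_⟩
  · rw [Finset.mem_singleton] at hS
    subst hS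
    have h3 := D.sum_toReal
    rw [Fintype.sum_eq_add_sum_compl x₀, hD x₀, if_pos rfl] at h3
    have : ∀ x ∈ ({x₀}ᶜ : Finset X),
        (if x ∈ Set.range (fun _ : Fin m => x₀) then 0 else (D x).toReal) = (D x).toReal :=
      fun x hx => if_neg fun ⟨_, h⟩ => by simp [← h] at hx
    rw [Fintype.sum_eq_add_sum_compl x₀, if_pos ⟨⟨0, hm⟩, rfl⟩, Finset.sum_congr rfl this]
    linarith
  · simp only [Finset.sum_singleton, hD, if_true, Finset.prod_const, Finset.card_univ,
      Fintype.card_fin]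
    have h1 : Real.exp (-(2 * ε)) ≤ 1 - ε := by
      rw [Real.exp_neg, inv_le_comm₀ (Real.exp_pos _) (by linarith)]
      refine le_trans ?_ (Real.add_one_le_exp _)
      rw [inv_le_iff_one_le_mul₀ (by linarith)]
      nlinarith
    set y := Real.exp (-(Real.log (1 / δ) / 2)) with hy
    have hy2 : y ^ 2 = δ := by
      rw [hy, ← Real.exp_nat_mul, one_div, Real.log_inv]
      push_cast
      rw [show (2 : ℝ) * -(-Real.log δ / 2) = Real.log δ by ring, Real.exp_log hδ0]
    have hy0 : 0 < y := Real.exp_pos _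
    calc 2 * δ ≤ y := by
          rw [← hy2]
          have : y ≤ 1 / 2 := by nlinarith
          nlinarith
      _ ≤ Real.exp (-(2 * ε)) ^ m := by
          rw [← Real.exp_nat_mul, hy]
          exact Real.exp_le_exp.2 (by linarith)
      _ ≤ (1 - ε) ^ m := by gcongr

end LowerBound

/-! ### Combining the two lower bounds -/

theorem mainTheorem3 :
    ∃ α : ℝ, 0 < α ∧
      ∀ (d : ℕ) (γ : ℝ), (2 : ℝ) ^ (-(d : ℤ)) < γ → γ < 1 / 80 →
        ∃ (X : Type) (_ : Fintype X) (C H : Set (X → ℤˣ)),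
          vcDimension H ≤ (d : ℕ∞) ∧
          (∀ c ∈ C, ∀ D' : PMF X, ∃ h ∈ H, loss D' c h ≤ 1 / 2 - γ) ∧
          ∀ (m : ℕ) (δ : ℝ), 1 ≤ m → 0 < δ → δ < 1 / 3 →
            ∃ D : PMF X, ∀ A : Learner X m, ∃ c ∈ C,
              ENNReal.ofReal δ ≤
                (A.output D c).toOuterMeasure
                  {h | α * min 1 (((d : ℝ) * γ ^ (-2 : ℤ) + Real.log (1 / δ)) / (m : ℝ)) ≤
                    loss D c h} := by
  obtain ⟨κ, hκ, hmain⟩ := exists_weakly_learnable_univ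
  refine ⟨min (1 / 16) (κ / 96), by positivity, fun d γ hdγ hγ => ?_⟩
  obtain ⟨X, hX, H, hH, hweak, hX2, hXc⟩ := hmain d γ hdγ hγ
  refine ⟨X, hX, Set.univ, H, hH, fun c _ => hweak c, fun m δ hm hδ0 hδ => ?_⟩
  have hm0 : (0 : ℝ) < m := by exact_mod_cast hm
  have hγ0 : 0 < γ := lt_trans (by positivity) hdγ
  set α := min (1 / 16 : ℝ) (κ / 96) with hα
  have hα0 : 0 < α := by positivity
  have hα1 : α ≤ 1 / 16 := min_le_left _ _
  have hα2 : α ≤ κ / 96 := min_le_right _ _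
  set G : ℝ := d * γ ^ (-2 : ℤ) with hG
  have hG2 : 2 ≤ G := by
    have hd : d ≠ 0 := by
      rintro rfl
      norm_num at hdγ
      linarith
    have hd1 : (1 : ℝ) ≤ d := by exact_mod_cast Nat.one_le_iff_ne_zero.2 hd
    have h1 : (2 : ℝ) ≤ γ ^ (-2 : ℤ) := by
      rw [zpow_neg, le_inv_comm₀ two_pos (by positivity)]
      norm_cast
      nlinarith
    rw [hG]
    nlinarith
  have hlift : ∀ θ : ℝ, α * min 1 ((G + Real.log (1 / δ)) / m) ≤ θ →
      (∃ D : PMF X, ∀ A : Learner X m, ∃ c : X → ℤˣ,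
        ENNReal.ofReal δ ≤ (A.output D c).toOuterMeasure {h | θ ≤ loss D c h}) →
      ∃ D : PMF X, ∀ A : Learner X m, ∃ c ∈ (Set.univ : Set (X → ℤˣ)),
        ENNReal.ofReal δ ≤ (A.output D c).toOuterMeasure
          {h | α * min 1 ((G + Real.log (1 / δ)) / m) ≤ loss D c h} := by
    rintro θ hθ ⟨D, hD⟩
    refine ⟨D, fun A => ?_⟩
    obtain ⟨c, hc⟩ := hD A
    exact ⟨c, Set.mem_univ _, hc.trans (MeasureTheory.measure_mono fun h hh => hθ.trans hh)⟩
  have hlog : 0 ≤ Real.log (1 / δ) := Real.log_nonneg (by rw [le_div_iff₀ hδ0]; linarith)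
  have hmin : 0 ≤ min 1 ((G + Real.log (1 / δ)) / m) := by positivity
  -- The sum is at most twice its larger term, and each term has its own distribution.
  rcases le_total (Real.log (1 / δ)) G with hcase | hcase
  · refine hlift _ ?_ (exists_distribution_loss_ge_card hX2 hm hδ)
    have hL : κ * G / 2 ≤ (Fintype.card X : ℝ) - 1 := by
      have : (2 : ℝ) ≤ Fintype.card X := by exact_mod_cast hX2
      linarith
    have h1 : min 1 ((G + Real.log (1 / δ)) / m) ≤ 1 := min_le_left _ _
    have h2 : min 1 ((G + Real.log (1 / δ)) / m) ≤ 2 * G / m :=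
      (min_le_right _ _).trans (by gcongr; linarith)
    have h3 : κ / 24 * (2 * G / m) ≤ ((Fintype.card X : ℝ) - 1) / (6 * m) := by
      rw [le_div_iff₀ (by positivity)]
      calc κ / 24 * (2 * G / m) * (6 * m) = κ * G / 2 := by field_simp; norm_num
        _ ≤ _ := hL
    rw [mul_min_of_nonneg _ _ (by norm_num : (0 : ℝ) ≤ 1 / 4)]
    refine le_min ?_ ?_
    · nlinarith
    · calc α * min 1 ((G + Real.log (1 / δ)) / m) ≤ κ / 96 * (2 * G / m) := by gcongr
        _ ≤ _ := by linarith
  -- Here `log (1 / δ) ≥ G ≥ 2 > log 4`.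
  · have hδ4 : δ ≤ 1 / 4 := by
      by_contra hcon
      push Not at hcon
      have h3 : Real.log (1 / δ) < Real.log 4 :=
        Real.log_lt_log (by positivity) (by rw [div_lt_iff₀ hδ0]; linarith)
      have h4 : Real.log 4 = 2 * Real.log 2 := by
        rw [show (4 : ℝ) = 2 ^ 2 by norm_num, Real.log_pow]; norm_num
      have := Real.log_two_lt_d9
      linarith
    refine hlift _ ?_ (exists_distribution_loss_ge_log hX2 hm hδ0 hδ4)
    have h1 : min 1 ((G + Real.log (1 / δ)) / m) ≤ 1 := min_le_left _ _
    have h2 : min 1 ((G + Real.log (1 / δ)) / m) ≤ 2 * Real.log (1 / δ) / m :=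
      (min_le_right _ _).trans (by gcongr; linarith)
    rw [mul_min_of_nonneg _ _ (by norm_num : (0 : ℝ) ≤ 1 / 2)]
    refine le_min ?_ ?_
    · nlinarith
    · calc α * min 1 ((G + Real.log (1 / δ)) / m) ≤ 1 / 16 * (2 * Real.log (1 / δ) / m) := by
            gcongr
        _ = _ := by ring
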